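/- Let $d,\tilde q\ge 0$ be integers, $\alpha>0$, and let $V_0,V_1,\dots,V_{\tilde q}:\mathbb{R}^d\to\mathbb{R}$ and $\beta:\mathbb{R}^d\to(0,\infty)$ be twice continuously differentiable. Put $\mathcal{C}=\{\theta\in\mathbb{R}^d : V_j(\theta)\le 0 \text{ for } j=1,\dots,\tilde q\}$ and, for $\theta,\xi\in\mathbb{R}^d$ and $j=1,\dots,\tilde q$, $$g_j(\xi,\theta)=\alpha V_j(\theta)+\nabla V_j(\theta)^\top\xi+\tfrac{\beta(\theta)}{2}\|\xi\|^2 .$$ Let $\mathcal{R}_{\alpha,\beta}(\theta)$ denote the solution of the parametric problem $$(P_\theta)\qquad \min_{\xi\in\mathbb{R}^d}\ \tfrac12\|\xi+\nabla V_0(\theta)\|^2\quad\text{subject to}\quad g_j(\xi,\theta)\le 0,\ j=1,\dots,\tilde q;$$ it is called well defined at $\theta$ if $(P_\theta)$ is feasible and has exactly one minimizer. (Where $(P_\theta)$ has no minimizer, put $\mathcal{R}_{\alpha,\beta}(\theta)=0$ by convention.) Consider the following conditions. * MFCQ at $\theta$: there is $\xi\in\mathbb{R}^d$ with $\nabla V_j(\theta)^\top\xi<0$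 for every $j$ with $V_j(\theta)=0$. * CRC at $\theta$: there is a neighborhood $\mathcal{N}$ of $(\mathcal{R}_{\alpha,\beta}(\theta),\theta)$ in $\mathbb{R}^d\times\mathbb{R}^d$ such that, for every $I\subseteq\{j : g_j(\mathcal{R}_{\alpha,\beta}(\theta),\theta)=0\}$, the rank of the family $\{\nabla_\xi g_j(\bar\xi,\bar\theta)\}_{j\in I}$ is constant over $(\bar\xi,\bar\theta)\in\mathcal{N}$. * Slater's condition at $\theta$: there is $\xi\in\mathbb{R}^d$ with $g_j(\xi,\theta)<0$ for all $j=1,\dots,\tilde q$. Then: 1. If MFCQ and CRC hold at every $\theta\in\mathcal{C}$, there is an open set $U\supseteq\mathcal{C}$ such that $\mathcal{R}_{\alpha,\beta}$ is well defined at every point of $U$ and locally Lipschitz on $U$. 2. If MFCQ and CRC hold at every $\theta\in\mathcal{C}$, and Slater's condition and CRC hold at every $\theta\in\mathbb{R}^d\setminus\mathcal{C}$, then $\mathcal{R}_{\alpha,\beta}$ is well defined at every point of $\mathbb{R}^d$ and locally Lipschitz on $\mathbb{R}^d$. -/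

import Mathlib

open scoped Gradient RealInnerProductSpace Topology

noncomputable section

namespace RSGF

variable {d c q : ℕ}

/-- The feasible set `{x | g j x ≤ 0 for all j}` of a nonlinear program with constraints `g`. -/
def feasibleSet (g : Fin q → EuclideanSpace ℝ (Fin d) → ℝ) : Set (EuclideanSpace ℝ (Fin d)) :=
  {x | ∀ j, g j x ≤ 0}

/-- The set of constraints that are active at `x`. -/
def activeSet (g : Fin q → EuclideanSpace ℝ (Fin d) → ℝ) (x : EuclideanSpace ℝ (Fin d)) :
    Set (Fin q) :=
  {j | g j x = 0}

/-- Slater's condition: some point satisfies all the constraints strictly. -/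
def SlaterCondition (g : Fin q → EuclideanSpace ℝ (Fin d) → ℝ) : Prop :=
  ∃ x, ∀ j, g j x < 0

/-- The Mangasarian-Fromovitz constraint qualification at `x`. -/
def MFCQAt (g : Fin q → EuclideanSpace ℝ (Fin d) → ℝ) (x : EuclideanSpace ℝ (Fin d)) : Prop :=
  ∃ ξ : EuclideanSpace ℝ (Fin d), ∀ j ∈ activeSet g x, ⟪∇ (g j) x, ξ⟫ < 0

/-- The constant-rank condition, at `(x₀, z₀)`, of the parametric nonlinear program with
constraints `g j x z ≤ 0` in the decision variable `x` and with the parameter `z`: on a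
neighborhood of `(x₀, z₀)`, for every set `I` of constraints active at `(x₀, z₀)`, the family
of partial gradients `∇ₓ g j x z`, `j ∈ I`, has constant rank. -/
def ParametricCRCAt
    (g : Fin q → EuclideanSpace ℝ (Fin d) → EuclideanSpace ℝ (Fin c) → ℝ)
    (x₀ : EuclideanSpace ℝ (Fin d)) (z₀ : EuclideanSpace ℝ (Fin c)) : Prop :=
  ∃ N ∈ 𝓝 (x₀, z₀), ∀ I ⊆ activeSet (fun j x => g j x z₀) x₀, ∃ r : ℕ, ∀ p ∈ N,
    Set.finrank ℝ ((fun j => ∇ (fun x => g j x p.2) p.1) '' I) = r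

/-- The objective `½ ‖ξ + ∇V₀(θ)‖²` of the program that defines the robust safe gradient flow. -/
def objective (V₀ : EuclideanSpace ℝ (Fin d) → ℝ) (ξ θ : EuclideanSpace ℝ (Fin d)) : ℝ :=
  1 / 2 * ‖ξ + ∇ V₀ θ‖ ^ 2

/-- The constraints `α V_j(θ) + ∇V_j(θ)ᵀ ξ + (β(θ)/2) ‖ξ‖² ≤ 0` of the program that defines the
robust safe gradient flow (decision variable `ξ`, parameter `θ`). -/
def constraint (α : ℝ) (β : EuclideanSpace ℝ (Fin d) → ℝ)
    (V : Fin q → EuclideanSpace ℝ (Fin d) → ℝ) (j : Fin q) (ξ θ : EuclideanSpace ℝ (Fin d)) : ℝ :=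
  α * V j θ + ⟪∇ (V j) θ, ξ⟫ + β θ / 2 * ‖ξ‖ ^ 2

/-- `ξ` is a minimizer of the program that defines the robust safe gradient flow at `θ`. -/
def IsSolution (α : ℝ) (β V₀ : EuclideanSpace ℝ (Fin d) → ℝ)
    (V : Fin q → EuclideanSpace ℝ (Fin d) → ℝ) (θ ξ : EuclideanSpace ℝ (Fin d)) : Prop :=
  ξ ∈ feasibleSet (fun j ζ => constraint α β V j ζ θ) ∧
    IsMinOn (fun ζ => objective V₀ ζ θ) (feasibleSet (fun j ζ => constraint α β V j ζ θ)) ξ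

open Classical in
/-- The vector field `R_{α,β}`: the minimizer of the defining program at `θ`
(and `0` if there is none). -/
def vectorField (α : ℝ) (β V₀ : EuclideanSpace ℝ (Fin d) → ℝ)
    (V : Fin q → EuclideanSpace ℝ (Fin d) → ℝ) (θ : EuclideanSpace ℝ (Fin d)) :
    EuclideanSpace ℝ (Fin d) :=
  if h : ∃ ξ, IsSolution α β V₀ V θ ξ then h.choose else 0

/-- `R_{α,β}` is well defined at `θ`: the defining program is feasible and has exactly one
minimizer, which is the value of `vectorField`. -/
def WellDefinedAt (α : ℝ) (β V₀ : EuclideanSpace ℝ (Fin d) → ℝ)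
    (V : Fin q → EuclideanSpace ℝ (Fin d) → ℝ) (θ : EuclideanSpace ℝ (Fin d)) : Prop :=
  (∃! ξ, IsSolution α β V₀ V θ ξ) ∧ IsSolution α β V₀ V θ (vectorField α β V₀ V θ)

/-- Constraint qualifications in the feasible set. -/
def QualifiedInside (α : ℝ) (β V₀ : EuclideanSpace ℝ (Fin d) → ℝ)
    (V : Fin q → EuclideanSpace ℝ (Fin d) → ℝ) : Prop :=
  ∀ θ ∈ feasibleSet V, MFCQAt V θ ∧
    ParametricCRCAt (constraint α β V) (vectorField α β V₀ V θ) θ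

/-- Constraint qualifications outside the feasible set. -/
def QualifiedOutside (α : ℝ) (β V₀ : EuclideanSpace ℝ (Fin d) → ℝ)
    (V : Fin q → EuclideanSpace ℝ (Fin d) → ℝ) : Prop :=
  ∀ θ ∉ feasibleSet V, SlaterCondition (fun j ξ => constraint α β V j ξ θ) ∧
    ParametricCRCAt (constraint α β V) (vectorField α β V₀ V θ) θ

end RSGF

end

/-! For fixed θ the minimizer is the point nearest to -∇V₀(θ) in a closed convex set, so it is
unique, and it exists as soon as the set is nonempty. Slater's condition persists under small
perturbations of θ and, on 𝒞, follows from MFCQ by a short step along the MFCQ direction. Everything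
therefore reduces to a local Lipschitz estimate at a point where Slater and CRC hold
(`exists_lipschitzOnWith_of_isNearest`).

Slater gives Karush-Kuhn-Tucker multipliers, and Carathéodory's theorem makes their active gradients
linearly independent (`IsNearest.exists_multipliers`). CRC carries this independence to the base
point, where only finitely many index sets occur; hence the independence is uniform nearby and the
multipliers are bounded. For two parameters with multipliers supported in the same index set I,
whose constraints are active at both, subtracting the KKT equations and pairing with the difference
of the minimizers bounds that difference linearly by the change of data
(`exists_norm_sub_le_of_common_support`).

The sets of parameters admitting a given I cover a ball, and there are finitely many of them. Since
the minimizer is also continuous (`continuousAt_of_isNearest`), the estimates on the pieces glue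
along segments (`norm_sub_le_of_finite_cover`). -/

/-! ### Conic combinations, theorems of the alternative and linear independence. -/

section ConicCombinations

variable {ι E : Type*} [Fintype ι]

/-- Carathéodory's theorem for conic combinations: a nonnegative combination of a finite family
can be rewritten with linearly independent support. -/
theorem exists_nonneg_linearIndepOn_support [AddCommGroup E] [Module ℝ E] (n : ι → E)
    (l : ι → ℝ) (hl : ∀ j, 0 ≤ l j) :
    ∃ m : ι → ℝ, (∀ j, 0 ≤ m j) ∧ (∀ j, m j ≠ 0 → l j ≠ 0) ∧
      ∑ j, m j • n j = ∑ j, l j • n j ∧ LinearIndepOn ℝ n {j | m j ≠ 0} := by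
  classical
  induction hk : (Finset.univ.filter fun j => l j ≠ 0).card using Nat.strong_induction_on
    generalizing l with
  | _ k ih =>
    by_cases hli : LinearIndepOn ℝ n {j | l j ≠ 0}
    · exact ⟨l, hl, fun _ h => h, rfl, hli⟩
    have hcoe : {j | l j ≠ 0} = ((Finset.univ.filter fun j => l j ≠ 0 : Finset ι) : Set ι) := by
      ext; simp
    rw [hcoe, not_linearIndepOn_finset_iff] at hli
    obtain ⟨g, hg, i, hi, hgi⟩ := hli
    -- The sign of the dependence is chosen so that some coefficient is positive; the ratio test
    -- below then has a candidate.
    obtain ⟨e, he, hei⟩ : ∃ e : ι → ℝ,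
        ∑ j ∈ Finset.univ.filter (fun j => l j ≠ 0), e j • n j = 0 ∧ 0 < e i := by
      rcases lt_or_gt_of_ne hgi with h | h
      · exact ⟨-g, by simp [hg], by simpa using h⟩
      · exact ⟨g, hg, h⟩
    obtain ⟨i₀, hi₀, hmin⟩ := Finset.exists_min_image
      (Finset.univ.filter fun j => l j ≠ 0 ∧ 0 < e j) (fun j => l j / e j)
      ⟨i, by simpa using ⟨by simpa using hi, hei⟩⟩
    simp only [Finset.mem_filter, Finset.mem_univ, true_and] at hi₀ hmin
    -- The largest multiple of the dependence that can be subtracted without losing nonnegativity;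
    -- it cancels the coefficient at `i₀`.
    set t := l i₀ / e i₀ with ht
    have ht0 : 0 ≤ t := div_nonneg (hl _) hi₀.2.le
    set l' : ι → ℝ := fun j => if l j ≠ 0 then l j - t * e j else 0 with hl'
    have hsupp : ∀ j, l' j ≠ 0 → l j ≠ 0 := by
      intro j hj h0
      exact hj (by simp [hl', h0])
    have hl'0 : ∀ j, 0 ≤ l' j := by
      intro j
      by_cases h0 : l j = 0
      · simp [hl', h0]
      · simp only [hl', ne_eq, h0, not_false_eq_true, if_true]
        rcases lt_or_ge 0 (e j) with h | h
        · have := hmin j ⟨h0, h⟩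
          rw [le_div_iff₀ h] at this
          linarith
        · nlinarith [hl j]
    have hsum : ∑ j, l' j • n j = ∑ j, l j • n j := by
      have h1 : ∑ j, l' j • n j
          = ∑ j ∈ Finset.univ.filter (fun j => l j ≠ 0), (l j - t * e j) • n j := by
        rw [Finset.sum_filter]
        refine Finset.sum_congr rfl fun j _ => ?_
        by_cases h0 : l j = 0 <;> simp [hl', h0]
      have h2 : ∑ j, l j • n j = ∑ j ∈ Finset.univ.filter (fun j => l j ≠ 0), l j • n j := by
        rw [Finset.sum_filter]
        refine Finset.sum_congr rfl fun j _ => ?_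
        by_cases h0 : l j = 0 <;> simp [h0]
      rw [h1, h2]
      simp only [sub_smul, mul_smul, Finset.sum_sub_distrib]
      rw [← Finset.smul_sum, he, smul_zero, sub_zero]
    have hcard : (Finset.univ.filter fun j => l' j ≠ 0).card < k := by
      rw [← hk]
      refine Finset.card_lt_card ⟨fun j => ?_, fun h => ?_⟩
      · simpa using hsupp j
      · have := @h i₀ (by simpa using hi₀.1)
        simp only [Finset.mem_filter, Finset.mem_univ, true_and] at this
        apply this
        have h3 : e i₀ ≠ 0 := hi₀.2.ne'
        simp only [hl', ne_eq, hi₀.1, not_false_eq_true, if_true, ht]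
        field_simp
        ring
    obtain ⟨m, hm0, hms, hmsum, hmli⟩ := ih _ hcard l' hl'0 rfl
    exact ⟨m, hm0, fun j hj => hsupp j (hms j hj), hmsum.trans hsum, hmli⟩

/-- Gordan's alternative. -/
theorem exists_convexCombination_eq_zero [NormedAddCommGroup E] [InnerProductSpace ℝ E]
    [CompleteSpace E] (w : ι → E) (hw : ∀ y, ∃ k, 0 ≤ ⟪w k, y⟫) :
    ∃ m ∈ stdSimplex ℝ ι, ∑ k, m k • w k = 0 := by
  set T : (ι → ℝ) →ₗ[ℝ] E := Fintype.linearCombination ℝ w with hT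
  by_contra hcon
  push Not at hcon
  have hcomp : IsCompact (T '' stdSimplex ℝ ι) :=
    (isCompact_stdSimplex ℝ ι).image (by
      change Continuous fun m : ι → ℝ => ∑ k, m k • w k
      fun_prop)
  have h0 : (0 : E) ∉ T '' stdSimplex ℝ ι := by
    rintro ⟨m, hm, h⟩
    exact hcon m hm h
  obtain ⟨f, u, hu, hf⟩ := geometric_hahn_banach_point_closed
    ((convex_stdSimplex ℝ ι).linear_image T) hcomp.isClosed h0
  -- The negated Riesz representative of the separating functional has negative inner product with
  -- every `w k`, contrary to `hw`.
  obtain ⟨k, hk⟩ := hw (-(InnerProductSpace.toDual ℝ E).symm f)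
  classical
  have h1 := hf (w k) ⟨Pi.single k 1, single_mem_stdSimplex ℝ k, by
    simp [hT, Fintype.linearCombination_apply_single]⟩
  rw [map_zero] at hu
  rw [inner_neg_right, real_inner_comm, InnerProductSpace.toDual_symm_apply] at hk
  linarith

/-- A linearly independent finite family is bounded below on coefficient vectors. -/
theorem LinearIndepOn.exists_mul_sum_abs_le [NormedAddCommGroup E] [NormedSpace ℝ E]
    {n : ι → E} {s : Set ι} (h : LinearIndepOn ℝ n s) :
    ∃ c > 0, ∀ m : ι → ℝ, (∀ j ∉ s, m j = 0) → c * ∑ j, |m j| ≤ ‖∑ j, m j • n j‖ := by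
  classical
  let W : Submodule ℝ (ι → ℝ) :=
    { carrier := {m | ∀ j ∉ s, m j = 0}
      add_mem' := fun {a b} ha hb j hj => by simp [ha j hj, hb j hj]
      zero_mem' := fun j _ => rfl
      smul_mem' := fun t a ha j hj => by simp [ha j hj] }
  let T : W →ₗ[ℝ] E := (Fintype.linearCombination ℝ n) ∘ₗ W.subtype
  have hker : LinearMap.ker T = ⊥ := by
    rw [LinearMap.ker_eq_bot']
    rintro ⟨m, hm⟩ h0
    have h1 : ∑ j, m j • n j = 0 := h0
    rw [linearIndepOn_iff'] at h
    ext j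
    by_cases hj : j ∈ s
    · refine h (Finset.univ.filter (· ∈ s)) m (by simp) ?_ j (by simpa using hj)
      rw [← h1, Finset.sum_filter]
      refine Finset.sum_congr rfl fun i _ => ?_
      by_cases hi : i ∈ s
      · simp [hi]
      · simp [hi, hm i hi]
    · exact hm j hj
  obtain ⟨K, hK, hanti⟩ := LinearMap.exists_antilipschitzWith T hker
  -- The cardinality converts the sup norm into the ℓ¹ norm; the added 1 keeps the constant positive
  -- when `ι` is empty.
  refine ⟨(K * (Fintype.card ι + 1))⁻¹, by positivity, fun m hm => ?_⟩
  have h1 := hanti.le_mul_dist (⟨m, hm⟩ : W) 0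
  rw [map_zero, dist_zero_right, dist_zero_right] at h1
  have h2 : ∑ j, |m j| ≤ Fintype.card ι * ‖m‖ := by
    calc ∑ j, |m j| ≤ ∑ _j : ι, ‖m‖ := Finset.sum_le_sum fun j _ => norm_le_pi_norm m j
      _ = _ := by simp
  have h3 : ‖m‖ ≤ K * ‖∑ j, m j • n j‖ := h1
  have h4 : 0 ≤ ‖m‖ := norm_nonneg m
  have hK' : (0 : ℝ) < K := hK
  rw [inv_mul_le_iff₀ (by positivity)]
  calc ∑ j, |m j| ≤ (Fintype.card ι + 1) * ‖m‖ := by linarith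
    _ ≤ (Fintype.card ι + 1) * (K * ‖∑ j, m j • n j‖) := by gcongr
    _ = _ := by ring

/-- Linear independence of a finite family passes to any family of the same rank. -/
theorem LinearIndepOn.of_finrank_image_eq [AddCommGroup E] [Module ℝ E] {n n' : ι → E} {s : Set ι}
    (h : LinearIndepOn ℝ n s) (hr : Set.finrank ℝ (n '' s) = Set.finrank ℝ (n' '' s)) :
    LinearIndepOn ℝ n' s := by
  classical
  rw [LinearIndepOn, linearIndependent_iff_card_eq_finrank_span] at h ⊢
  rw [Set.image_eq_range, Set.image_eq_range] at hr
  exact h.trans hr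

end ConicCombinations

/-! ### Gluing Lipschitz estimates along segments. -/

section Gluing

/-- A continuous map on a convex set covered by finitely many sets is `L`-Lipschitz as soon as it is
`L`-Lipschitz on each of these sets. -/
theorem norm_sub_le_of_finite_cover {ι P E : Type*} [Finite ι] [NormedAddCommGroup P]
    [NormedSpace ℝ P] [NormedAddCommGroup E] {f : P → E} {s : Set P} {A : ι → Set P} {L : ℝ}
    (hs : Convex ℝ s) (hf : ContinuousOn f s) (hA : ∀ x ∈ s, ∃ i, x ∈ A i)
    (hL : ∀ i, ∀ x ∈ s ∩ A i, ∀ y ∈ s ∩ A i, ‖f x - f y‖ ≤ L * ‖x - y‖)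
    {x y : P} (hx : x ∈ s) (hy : y ∈ s) : ‖f y - f x‖ ≤ L * ‖y - x‖ := by
  set γ : ℝ → P := fun t => x + t • (y - x) with hγ
  have hγs : ∀ t ∈ Set.Icc (0 : ℝ) 1, γ t ∈ s := fun t ht => hs.add_smul_sub_mem hx hy ht
  have hγc : Continuous γ := by fun_prop
  have hsub : ∀ t u, ‖γ t - γ u‖ = |t - u| * ‖y - x‖ := by
    intro t u
    rw [← Real.norm_eq_abs, ← norm_smul]
    congr 1
    simp only [hγ]
    module
  have hcont : ContinuousOn (fun t => f (γ t)) (Set.Icc 0 1) :=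
    hf.comp hγc.continuousOn hγs
  set C := L * ‖y - x‖ with hC
  -- The slack `ε` supplies the strict inequality of derivatives required by the boundary comparison
  -- theorem.
  refine le_of_forall_pos_le_add fun ε hε => ?_
  have key := image_norm_le_of_liminf_right_slope_norm_lt_deriv_boundary
    (f := fun t => f (γ t) - f x) (f' := fun _ => C) (a := 0) (b := 1)
    (B := fun t => (C + ε) * t) (B' := fun _ => C + ε)
    (hcont.sub continuousOn_const) ?_ (by simp [hγ]) (by fun_prop) ?_ ?_
    (x := 1) (by simp)
  · simpa [hγ] using key
  · intro t ht r hr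
    have hev : ∀ᶠ z in 𝓝[>] t, z ∈ Set.Ioo t 1 := Ioo_mem_nhdsGT ht.2
    -- By finiteness one piece is visited arbitrarily close to the right of `t`. The point `γ t`
    -- need not lie in it: the estimate is taken between two visits `z` and `w`, and then `w` tends
    -- to `t`, so continuity replaces closedness of the pieces.
    obtain ⟨i, hi⟩ : ∃ i, ∃ᶠ z in 𝓝[>] t, γ z ∈ A i := by
      by_contra hcon
      push Not at hcon
      rw [← Filter.eventually_all] at hcon
      obtain ⟨z, hz, hz'⟩ := (hcon.and hev).exists
      obtain ⟨i, hi⟩ := hA (γ z) (hγs z ⟨ht.1.trans hz'.1.le, hz'.2.le⟩)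
      exact hz i hi
    refine (hi.and_eventually hev).mono fun z ⟨hzA, hz⟩ => ?_
    have hzs := hγs z ⟨ht.1.trans hz.1.le, hz.2.le⟩
    have hlim : Filter.Tendsto (fun w => |z - w| * ‖y - x‖ * L - ‖f (γ z) - f (γ w)‖) (𝓝[>] t)
        (𝓝 (|z - t| * ‖y - x‖ * L - ‖f (γ z) - f (γ t)‖)) := by
      have h1 : Filter.Tendsto (fun w => f (γ w)) (𝓝[>] t) (𝓝 (f (γ t))) := by
        refine (hcont t ⟨ht.1, ht.2.le⟩).mono_left (nhdsWithin_le_of_mem ?_)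
        filter_upwards [hev] with w hw using ⟨ht.1.trans hw.1.le, hw.2.le⟩
      have h2 : Filter.Tendsto (fun w : ℝ => w) (𝓝[>] t) (𝓝 t) := nhdsWithin_le_nhds
      exact ((((tendsto_const_nhds.sub h2).abs).mul_const _).mul_const _).sub
        (tendsto_const_nhds.sub h1).norm
    have hle : 0 ≤ |z - t| * ‖y - x‖ * L - ‖f (γ z) - f (γ t)‖ := by
      refine ge_of_tendsto_of_frequently hlim ((hi.and_eventually hev).mono fun w ⟨hwA, hw⟩ => ?_)
      have := hL i _ ⟨hzs, hzA⟩ _ ⟨hγs w ⟨ht.1.trans hw.1.le, hw.2.le⟩, hwA⟩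
      rw [hsub] at this
      linarith
    have hzt : 0 < z - t := sub_pos.2 hz.1
    rw [abs_of_pos hzt] at hle
    rw [slope_def_field, div_lt_iff₀ hzt]
    have htri : ‖f (γ z) - f x‖ - ‖f (γ t) - f x‖ ≤ ‖f (γ z) - f (γ t)‖ := by
      simpa using norm_sub_norm_le (f (γ z) - f x) (f (γ t) - f x)
    simp only [Function.comp_apply]
    nlinarith
  · intro t _
    simpa using ((hasDerivAt_id t).const_mul (C + ε)).hasDerivWithinAt
  · intro t _ _
    linarith

end Gluing

/-! ### Nearest points under quadratic constraints with a common curvature. -/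

section BallConstraints

variable {ι E : Type*} [NormedAddCommGroup E] [InnerProductSpace ℝ E]

/-- The convex quadratic `v + ⟪a, ξ⟫ + (b / 2) ‖ξ‖²`. -/
noncomputable def ballConstraint (v : ℝ) (a : E) (b : ℝ) (ξ : E) : ℝ :=
  v + ⟪a, ξ⟫ + b / 2 * ‖ξ‖ ^ 2

/-- The Taylor expansion is exact: the gradient at `x` is `a + b • x` and the Hessian is `b` times
the identity. Convexity, the KKT conditions and the Lipschitz estimate all rest on this identity. -/
theorem ballConstraint_add (v : ℝ) (a : E) (b : ℝ) (x h : E) :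
    ballConstraint v a b (x + h) = ballConstraint v a b x + ⟪a + b • x, h⟫ + b / 2 * ‖h‖ ^ 2 := by
  simp only [ballConstraint, norm_add_sq_real, inner_add_left, inner_add_right, inner_smul_left,
    RCLike.conj_to_real]
  ring

/-- The intersection of the sublevel sets of the quadratics `ballConstraint (v j) (a j) b`. -/
def ballFeasible (v : ι → ℝ) (a : ι → E) (b : ℝ) : Set E :=
  {x | ∀ j, ballConstraint (v j) (a j) b x ≤ 0}

/-- `x` is a point of `ballFeasible v a b` nearest to `-p`. -/
def IsNearest (p : E) (v : ι → ℝ) (a : ι → E) (b : ℝ) (x : E) : Prop :=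
  x ∈ ballFeasible v a b ∧ ∀ y ∈ ballFeasible v a b, ‖x + p‖ ≤ ‖y + p‖

theorem continuous_ballConstraint :
    Continuous fun z : ℝ × E × ℝ × E => ballConstraint z.1 z.2.1 z.2.2.1 z.2.2.2 := by
  unfold ballConstraint
  fun_prop

theorem ballConstraint_lineMap_le (v : ℝ) (a : E) {b : ℝ} (hb : 0 ≤ b) (x y : E) {t : ℝ}
    (ht : 0 ≤ t) (ht' : t ≤ 1) : ballConstraint v a b (x + t • (y - x)) ≤
      (1 - t) * ballConstraint v a b x + t * ballConstraint v a b y := by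
  have h := ballConstraint_add v a b x (y - x)
  rw [add_sub_cancel] at h
  rw [ballConstraint_add, inner_smul_right, norm_smul, mul_pow, Real.norm_eq_abs, sq_abs, h]
  have h4 : 0 ≤ b / 2 * ‖y - x‖ ^ 2 := by positivity
  nlinarith [mul_nonneg (mul_nonneg ht (sub_nonneg.2 ht')) h4]

theorem convex_ballFeasible (v : ι → ℝ) (a : ι → E) {b : ℝ} (hb : 0 ≤ b) :
    Convex ℝ (ballFeasible v a b) := by
  intro x hx y hy s t hs ht hst j
  obtain rfl : s = 1 - t := by linarith
  have e : (1 - t) • x + t • y = x + t • (y - x) := by module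
  rw [e]
  refine (ballConstraint_lineMap_le _ _ hb x y ht (by linarith)).trans ?_
  exact add_nonpos (mul_nonpos_of_nonneg_of_nonpos hs (hx j))
    (mul_nonpos_of_nonneg_of_nonpos ht (hy j))

theorem isClosed_ballFeasible (v : ι → ℝ) (a : ι → E) (b : ℝ) :
    IsClosed (ballFeasible v a b) := by
  have : ballFeasible v a b = ⋂ j, {x | ballConstraint (v j) (a j) b x ≤ 0} := by
    ext; simp [ballFeasible]
  rw [this]
  refine isClosed_iInter fun j => isClosed_le ?_ continuous_const
  unfold ballConstraint
  fun_prop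

theorem exists_isNearest [FiniteDimensional ℝ E] (p : E) {v : ι → ℝ} {a : ι → E} {b : ℝ}
    (h : (ballFeasible v a b).Nonempty) : ∃ x, IsNearest p v a b x := by
  obtain ⟨x, hx, hd⟩ := (isClosed_ballFeasible v a b).exists_infDist_eq_dist h (-p)
  refine ⟨x, hx, fun y hy => ?_⟩
  have := Metric.infDist_le_dist_of_mem (x := -p) hy
  rw [hd, dist_comm, dist_comm _ y, dist_eq_norm, dist_eq_norm] at this
  simpa using this

/-- The midpoint is feasible by convexity, so the parallelogram law leaves no room for a positive
distance. -/
theorem IsNearest.eq {p : E} {v : ι → ℝ} {a : ι → E} {b : ℝ} (hb : 0 ≤ b) {x y : E}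
    (hx : IsNearest p v a b x) (hy : IsNearest p v a b y) : x = y := by
  have hm := hx.2 _ (convex_ballFeasible v a hb hx.1 hy.1 (by norm_num : (0 : ℝ) ≤ 1 / 2)
    (by norm_num : (0 : ℝ) ≤ 1 / 2) (by norm_num))
  have hxy := le_antisymm (hx.2 y hy.1) (hy.2 x hx.1)
  have hpar := parallelogram_law_with_norm ℝ (x + p) (y + p)
  have e1 : x + p + (y + p) = (2 : ℝ) • ((1 / 2 : ℝ) • x + (1 / 2 : ℝ) • y + p) := by module
  have e2 : x + p - (y + p) = x - y := by abel
  rw [e1, e2, norm_smul, ← hxy, Real.norm_two] at hpar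
  have h0 : ‖x - y‖ * ‖x - y‖ ≤ 0 := by
    nlinarith [mul_self_le_mul_self (norm_nonneg _) hm]
  have h1 : ‖x - y‖ = 0 := mul_self_eq_zero.1 (le_antisymm h0 (mul_self_nonneg _))
  exact sub_eq_zero.1 (norm_eq_zero.1 h1)

/-- Karush-Kuhn-Tucker conditions under Slater's condition, with multipliers whose active gradients
are linearly independent. -/
theorem IsNearest.exists_multipliers [Fintype ι] [CompleteSpace E] {p : E} {v : ι → ℝ}
    {a : ι → E} {b : ℝ} {x : E} (hb : 0 ≤ b) (hx : IsNearest p v a b x)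
    (hs : ∃ s, ∀ j, ballConstraint (v j) (a j) b s < 0) :
    ∃ l : ι → ℝ, (∀ j, 0 ≤ l j) ∧ (∀ j, l j ≠ 0 → ballConstraint (v j) (a j) b x = 0) ∧
      x + p + ∑ j, l j • (a j + b • x) = 0 ∧
      LinearIndepOn ℝ (fun j => a j + b • x) {j | l j ≠ 0} := by
  classical
  obtain ⟨s, hs⟩ := hs
  let A := {j // ballConstraint (v j) (a j) b x = 0}
  -- `none` carries the gradient of the objective, `some j` that of an active constraint. A
  -- direction with negative inner product with all of them would be a feasible descent direction,
  -- so Gordan's alternative yields Fritz John multipliers.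
  let w : Option A → E := fun k => k.elim (x + p) fun j => a j.1 + b • x
  have hsd : ∀ j : A, ⟪a j.1 + b • x, s - x⟫ < 0 := by
    intro j
    have h1 := ballConstraint_add (v j.1) (a j.1) b x (s - x)
    rw [add_sub_cancel, j.2] at h1
    have h2 := hs j.1
    have h3 : 0 ≤ b / 2 * ‖s - x‖ ^ 2 := by positivity
    linarith
  obtain ⟨m, ⟨hm0, hm1⟩, hm⟩ := exists_convexCombination_eq_zero w (by
    intro y
    by_contra hcon
    push Not at hcon
    have h0 : ⟪x + p, y⟫ < 0 := hcon none
    have hA : ∀ j : ι, ∀ᶠ t : ℝ in 𝓝[>] 0, ballConstraint (v j) (a j) b (x + t • y) ≤ 0 := by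
      intro j
      rcases (hx.1 j).lt_or_eq with h | h
      · have hc : Continuous fun t : ℝ => ballConstraint (v j) (a j) b (x + t • y) := by
          unfold ballConstraint
          fun_prop
        have := hc.tendsto 0
        simp only [zero_smul, add_zero] at this
        filter_upwards [nhdsWithin_le_nhds (this.eventually_lt_const h)] with t ht using ht.le
      · have h1 : ⟪a j + b • x, y⟫ < 0 := hcon (some ⟨j, h⟩)
        have hc : Filter.Tendsto (fun t : ℝ => ⟪a j + b • x, y⟫ + t * (b / 2 * ‖y‖ ^ 2)) (𝓝 0)
            (𝓝 (⟪a j + b • x, y⟫ + 0 * (b / 2 * ‖y‖ ^ 2))) := Continuous.tendsto (by fun_prop) 0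
        rw [zero_mul, add_zero] at hc
        filter_upwards [nhdsWithin_le_nhds (hc.eventually_lt_const h1), self_mem_nhdsWithin]
          with t ht ht0
        rw [ballConstraint_add, h, inner_smul_right, norm_smul, mul_pow, Real.norm_eq_abs, sq_abs]
        nlinarith [mul_neg_of_pos_of_neg (Set.mem_Ioi.1 ht0) ht]
    have hB : ∀ᶠ t : ℝ in 𝓝[>] 0, 2 * ⟪x + p, y⟫ + t * ‖y‖ ^ 2 < 0 := by
      have hc : Filter.Tendsto (fun t : ℝ => 2 * ⟪x + p, y⟫ + t * ‖y‖ ^ 2) (𝓝 0)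
          (𝓝 (2 * ⟪x + p, y⟫ + 0 * ‖y‖ ^ 2)) := Continuous.tendsto (by fun_prop) 0
      exact nhdsWithin_le_nhds (hc.eventually_lt_const (by linarith))
    obtain ⟨t, ⟨htA, htB⟩, ht0⟩ :=
      (((Filter.eventually_all.2 hA).and hB).and self_mem_nhdsWithin).exists
    have h2 := hx.2 _ htA
    have h3 : x + t • y + p = x + p + t • y := by abel
    have h4 : ‖x + p + t • y‖ ^ 2 < ‖x + p‖ ^ 2 := by
      rw [norm_add_sq_real, inner_smul_right, norm_smul, mul_pow, Real.norm_eq_abs, sq_abs]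
      nlinarith [mul_neg_of_pos_of_neg (Set.mem_Ioi.1 ht0) htB]
    rw [h3] at h2
    exact absurd h4 (not_lt.2 (pow_le_pow_left₀ (norm_nonneg _) h2 2)))
  rw [Fintype.sum_option] at hm hm1
  simp only [w, Option.elim_none, Option.elim_some] at hm
  -- Slater excludes a vanishing objective multiplier: the direction `s - x` strictly decreases
  -- every active constraint to first order.
  have hpos : 0 < m none := by
    refine (hm0 none).lt_of_ne fun h0 => ?_
    rw [← h0, zero_smul, zero_add] at hm
    rw [← h0, zero_add] at hm1
    have h1 : ∑ j : A, m (some j) * ⟪a j.1 + b • x, s - x⟫ = 0 := by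
      have := congrArg (fun z => ⟪z, s - x⟫) hm
      simpa only [sum_inner, real_inner_smul_left, inner_zero_left] using this
    obtain ⟨j, -, hj⟩ : ∃ j ∈ (Finset.univ : Finset A), 0 < m (some j) := by
      by_contra hcon
      push Not at hcon
      have := Finset.sum_nonpos hcon
      linarith
    have h2 : ∑ j : A, m (some j) * ⟪a j.1 + b • x, s - x⟫ < 0 :=
      Finset.sum_neg' (fun i _ => mul_nonpos_of_nonneg_of_nonpos (hm0 _) (hsd i).le)
        ⟨j, Finset.mem_univ _, mul_neg_of_pos_of_neg hj (hsd j)⟩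
    linarith
  let l : ι → ℝ := fun j =>
    if h : ballConstraint (v j) (a j) b x = 0 then m (some ⟨j, h⟩) / m none else 0
  have hl0 : ∀ j, 0 ≤ l j := by
    intro j
    by_cases h : ballConstraint (v j) (a j) b x = 0
    · simp only [l, h, dif_pos]
      exact div_nonneg (hm0 _) hpos.le
    · simp [l, h]
  have hlsum : x + p + ∑ j, l j • (a j + b • x) = 0 := by
    rw [← Fintype.sum_subtype_add_sum_subtype (fun j => ballConstraint (v j) (a j) b x = 0)]
    have h1 : ∑ j : {j // ¬ ballConstraint (v j) (a j) b x = 0}, l j.1 • (a j.1 + b • x) = 0 :=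
      Finset.sum_eq_zero fun j _ => by simp [l, j.2]
    have h2 : ∑ j : A, l j.1 • (a j.1 + b • x)
        = (m none)⁻¹ • ∑ j : A, m (some j) • (a j.1 + b • x) := by
      rw [Finset.smul_sum]
      refine Finset.sum_congr rfl fun j _ => ?_
      rw [smul_smul]
      congr 1
      simp only [l, j.2, dif_pos]
      rw [div_eq_inv_mul]
    rw [h1, add_zero]
    have h3 : ∑ j : A, m (some j) • (a j.1 + b • x) = -(m none • (x + p)) :=
      (neg_eq_of_add_eq_zero_right hm).symm
    erw [h2, h3]
    rw [smul_neg, smul_smul, inv_mul_cancel₀ hpos.ne', one_smul, add_neg_cancel]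
  obtain ⟨l', hl'0, hl's, hl'sum, hl'li⟩ :=
    exists_nonneg_linearIndepOn_support (fun j => a j + b • x) l hl0
  refine ⟨l', hl'0, fun j hj => ?_, ?_, hl'li⟩
  · by_contra h
    exact hl's j hj (by simp [l, h])
  · rw [hl'sum, hlsum]

/-- If the conclusion failed, then δ ≤ y, so the right-hand side would be at most (B + D)δy < y². -/
theorem le_of_sq_le_linear_add_sq {B D δ y : ℝ} (hB : 0 ≤ B) (hD : 0 ≤ D) (hδ : 0 ≤ δ)
    (h : y ^ 2 ≤ B * δ * y + D * δ ^ 2) : y ≤ (B + D + 1) * δ := by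
  by_contra hcon
  push Not at hcon
  have hyδ : δ ≤ y := by nlinarith [mul_nonneg (add_nonneg hB hD) hδ]
  have hy : 0 < y := by nlinarith [mul_nonneg (add_nonneg hB hD) hδ]
  have h1 := mul_lt_mul_of_pos_right hcon hy
  have h2 := mul_le_mul_of_nonneg_left hyδ (mul_nonneg hD hδ)
  nlinarith [mul_nonneg hδ hy.le]

set_option maxHeartbeats 800000 in
/-- Two Karush-Kuhn-Tucker points with a common set of positive multipliers are at a distance
controlled by the distance of the data. -/
theorem exists_norm_sub_le_of_common_support [Fintype ι] (K M : ℝ) (hK : 0 ≤ K) (hM : 0 ≤ M)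
    {c : ℝ} (hc : 0 < c) : ∃ L : ℝ, 0 ≤ L ∧
    ∀ (p p' : E) (v v' : ι → ℝ) (a a' : ι → E) (b b' : ℝ) (x x' : E) (l l' : ι → ℝ) (δ : ℝ),
      0 ≤ δ → 0 ≤ b → (∀ j, 0 ≤ l j) → (∀ j, 0 ≤ l' j) →
      (∀ j, l j ≠ 0 ∨ l' j ≠ 0 →
        ballConstraint (v j) (a j) b x = 0 ∧ ballConstraint (v' j) (a' j) b' x' = 0) →
      x + p + ∑ j, l j • (a j + b • x) = 0 → x' + p' + ∑ j, l' j • (a' j + b' • x') = 0 →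
      ‖p - p'‖ ≤ K * δ → (∀ j, |v j - v' j| ≤ K * δ) → (∀ j, ‖a j - a' j‖ ≤ K * δ) →
      |b - b'| ≤ K * δ → b ≤ M → ‖x'‖ ≤ M → ∑ j, l j ≤ M → ∑ j, l' j ≤ M →
      c * ∑ j, |l j - l' j| ≤ ‖∑ j, (l j - l' j) • (a j + b • x')‖ →
      ‖x - x'‖ ≤ L * δ := by
  set C := K * (1 + M + M ^ 2) with hC
  have hC0 : 0 ≤ C := by positivity
  set B := C * (1 + M ^ 2 + c) / c with hB
  set D := C ^ 2 / c with hD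
  have hB0 : 0 ≤ B := by positivity
  have hD0 : 0 ≤ D := by positivity
  refine ⟨B + D + 1, by positivity, ?_⟩
  intro p p' v v' a a' b b' x x' l l' δ hδ hb hl hl' hact hkkt hkkt' hp hv ha hbb hbM hx' hlM hlM'
    hli
  set y := ‖x - x'‖ with hy
  set S := ∑ j, |l j - l' j| with hS
  have hKδ : 0 ≤ K * δ := by positivity
  set R := (p - p') + ∑ j, l' j • ((a j - a' j) + (b - b') • x') with hR
  have hRn : ‖R‖ ≤ C * δ := by
    have h1 : ∀ j, ‖l' j • ((a j - a' j) + (b - b') • x')‖ ≤ l' j * (K * δ * (1 + M)) := by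
      intro j
      rw [norm_smul, Real.norm_eq_abs, abs_of_nonneg (hl' j)]
      refine mul_le_mul_of_nonneg_left ?_ (hl' j)
      refine (norm_add_le _ _).trans ?_
      rw [norm_smul, Real.norm_eq_abs]
      nlinarith [ha j, mul_le_mul hbb hx' (norm_nonneg _) hKδ]
    calc ‖R‖ ≤ ‖p - p'‖ + ∑ j, ‖l' j • ((a j - a' j) + (b - b') • x')‖ :=
          (norm_add_le _ _).trans (by gcongr; exact norm_sum_le _ _)
      _ ≤ K * δ + ∑ j, l' j * (K * δ * (1 + M)) := by
          gcongr with j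
          exact h1 j
      _ = K * δ + (∑ j, l' j) * (K * δ * (1 + M)) := by rw [Finset.sum_mul]
      _ ≤ K * δ + M * (K * δ * (1 + M)) := by gcongr
      _ = C * δ := by rw [hC]; ring
  -- The difference of the two KKT equations, arranged around the mixed gradients `a j + b • x'`;
  -- `R` collects the change of data.
  have hvec : (1 + b * ∑ j, l j) • (x - x') + ∑ j, (l j - l' j) • (a j + b • x') + R = 0 := by
    have e1 : (1 + b * ∑ j, l j) • (x - x') = (x - x') + ∑ j, l j • (b • (x - x')) := by
      rw [← Finset.sum_smul, smul_smul, add_smul, one_smul, mul_comm]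
    have e2 : (x + p + ∑ j, l j • (a j + b • x)) - (x' + p' + ∑ j, l' j • (a' j + b' • x')) = 0 := by
      rw [hkkt, hkkt', sub_zero]
    rw [e1, hR, ← e2]
    have e3 : ∑ j, l j • (b • (x - x')) + ∑ j, (l j - l' j) • (a j + b • x')
        + ∑ j, l' j • ((a j - a' j) + (b - b') • x')
        = ∑ j, l j • (a j + b • x) - ∑ j, l' j • (a' j + b' • x') := by
      rw [← Finset.sum_add_distrib, ← Finset.sum_add_distrib, ← Finset.sum_sub_distrib]
      refine Finset.sum_congr rfl fun j _ => ?_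
      module
    calc _ = (x - x') + (p - p') + (∑ j, l j • (b • (x - x'))
          + ∑ j, (l j - l' j) • (a j + b • x')
          + ∑ j, l' j • ((a j - a' j) + (b - b') • x')) := by abel
      _ = _ := by rw [e3]; abel
  have hs0 : 0 ≤ ∑ j, l j := Finset.sum_nonneg fun j _ => hl j
  have hs0' : 0 ≤ ∑ j, l' j := Finset.sum_nonneg fun j _ => hl' j
  have hSle : c * S ≤ (1 + M ^ 2) * y + C * δ := by
    refine hli.trans ?_
    have e : ∑ j, (l j - l' j) • (a j + b • x') = -((1 + b * ∑ j, l j) • (x - x') + R) := by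
      rw [eq_neg_iff_add_eq_zero, ← hvec]; abel
    rw [e, norm_neg]
    refine (norm_add_le _ _).trans ?_
    rw [norm_smul, Real.norm_eq_abs, abs_of_nonneg (by positivity)]
    gcongr
    nlinarith [mul_le_mul hbM hlM hs0 hM]
  -- Where a multiplier is nonzero both constraints vanish, so the expansion at `x'` leaves only a
  -- data error and the curvature term. Elsewhere the coefficient is zero.
  have he : ∀ j, ∃ e : ℝ, |e| ≤ C * δ ∧
      (l j - l' j) * ⟪a j + b • x', x - x'⟫ = (l j - l' j) * (e - b / 2 * y ^ 2) := by
    intro j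
    by_cases h : l j ≠ 0 ∨ l' j ≠ 0
    · obtain ⟨h1, h2⟩ := hact j h
      refine ⟨-((v j - v' j) + ⟪a j - a' j, x'⟫ + (b - b') / 2 * ‖x'‖ ^ 2), ?_, ?_⟩
      · rw [abs_neg]
        have i1 : |⟪a j - a' j, x'⟫| ≤ K * δ * M :=
          (abs_real_inner_le_norm _ _).trans (mul_le_mul (ha j) hx' (norm_nonneg _) hKδ)
        have i2 : |(b - b') / 2 * ‖x'‖ ^ 2| ≤ K * δ * M ^ 2 := by
          rw [abs_mul, abs_div, abs_of_nonneg (sq_nonneg ‖x'‖), abs_two]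
          refine mul_le_mul (by linarith) (by gcongr) (by positivity) hKδ
        calc _ ≤ |v j - v' j| + |⟪a j - a' j, x'⟫| + |(b - b') / 2 * ‖x'‖ ^ 2| := abs_add_three _ _ _
          _ ≤ K * δ + K * δ * M + K * δ * M ^ 2 := add_le_add_three (hv j) i1 i2
          _ = C * δ := by rw [hC]; ring
      · congr 1
        have h3 := ballConstraint_add (v j) (a j) b x' (x - x')
        rw [add_sub_cancel, h1] at h3
        have h4 : ballConstraint (v j) (a j) b x' - ballConstraint (v' j) (a' j) b' x'
            = (v j - v' j) + ⟪a j - a' j, x'⟫ + (b - b') / 2 * ‖x'‖ ^ 2 := by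
          simp only [ballConstraint, inner_sub_left]; ring
        rw [h2] at h4
        linarith
    · push Not at h
      exact ⟨0, by rw [abs_zero]; positivity, by simp [h.1, h.2]⟩
  choose e heC he using he
  have hinner : (1 + b * ∑ j, l j) * y ^ 2 + ∑ j, (l j - l' j) * (e j - b / 2 * y ^ 2)
      + ⟪R, x - x'⟫ = 0 := by
    have := congrArg (fun z => ⟪z, x - x'⟫) hvec
    simp only [inner_add_left _ R, inner_add_left (_ • (x - x')), real_inner_smul_left, sum_inner,
      inner_zero_left, real_inner_self_eq_norm_sq] at this
    rw [← this, Finset.sum_congr rfl fun j _ => (he j).symm]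
  have hsplit : ∑ j, (l j - l' j) * (e j - b / 2 * y ^ 2)
      = ∑ j, (l j - l' j) * e j - (∑ j, l j - ∑ j, l' j) * (b / 2 * y ^ 2) := by
    rw [← Finset.sum_sub_distrib, Finset.sum_mul, ← Finset.sum_sub_distrib]
    exact Finset.sum_congr rfl fun j _ => by ring
  have hsumle : |∑ j, (l j - l' j) * e j| ≤ S * (C * δ) := by
    refine (Finset.abs_sum_le_sum_abs _ _).trans ?_
    rw [hS, Finset.sum_mul]
    refine Finset.sum_le_sum fun j _ => ?_
    rw [abs_mul]
    exact mul_le_mul_of_nonneg_left (heC j) (abs_nonneg _)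
  have hRle : |⟪R, x - x'⟫| ≤ C * δ * y :=
    (abs_real_inner_le_norm _ _).trans (mul_le_mul_of_nonneg_right hRn (norm_nonneg _))
  have hy0 : 0 ≤ y := norm_nonneg _
  -- The curvature terms add up to b/2 (∑l + ∑l') y² ≥ 0. They can be dropped whatever the sign of
  -- ∑l - ∑l', and this uses that all constraints share the same `b`.
  have hmain : y ^ 2 ≤ C * δ * (S + y) := by
    have h1 := neg_abs_le (∑ j, (l j - l' j) * e j)
    have h2 := neg_abs_le ⟪R, x - x'⟫
    have h3 : 0 ≤ (∑ j, l j + ∑ j, l' j) * (b / 2 * y ^ 2) := by positivity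
    rw [hsplit] at hinner
    nlinarith
  have hfin : y ^ 2 ≤ B * δ * y + D * δ ^ 2 := by
    have h1 : S ≤ ((1 + M ^ 2) * y + C * δ) / c := by
      rw [le_div_iff₀ hc]; linarith
    calc y ^ 2 ≤ C * δ * (S + y) := hmain
      _ ≤ C * δ * (((1 + M ^ 2) * y + C * δ) / c + y) := by gcongr
      _ = B * δ * y + D * δ ^ 2 := by rw [hB, hD]; field_simp; ring
  exact le_of_sq_le_linear_add_sq hB0 hD0 hδ hfin

end BallConstraints

/-! ### Continuity and Lipschitz dependence on the parameter. -/

section ParametricNearest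

variable {ι E P : Type*} [NormedAddCommGroup E] [InnerProductSpace ℝ E]

theorem Filter.Tendsto.ballConstraint {X : Type*} {F : Filter X} {v b : X → ℝ} {a x : X → E}
    {v₀ b₀ : ℝ} {a₀ x₀ : E} (hv : Filter.Tendsto v F (𝓝 v₀)) (ha : Filter.Tendsto a F (𝓝 a₀))
    (hb : Filter.Tendsto b F (𝓝 b₀)) (hx : Filter.Tendsto x F (𝓝 x₀)) :
    Filter.Tendsto (fun t => _root_.ballConstraint (v t) (a t) (b t) (x t)) F
      (𝓝 (_root_.ballConstraint v₀ a₀ b₀ x₀)) :=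
  (continuous_ballConstraint.tendsto (v₀, a₀, b₀, x₀)).comp
    (hv.prodMk_nhds (ha.prodMk_nhds (hb.prodMk_nhds hx)))

/-- A strictly feasible point remains strictly feasible for nearby parameters. -/
theorem eventually_ballConstraint_neg [Finite ι] [TopologicalSpace P] {v : ι → P → ℝ}
    {a : ι → P → E} {b : P → ℝ} {θ₀ : P} (hv : ∀ j, ContinuousAt (v j) θ₀)
    (ha : ∀ j, ContinuousAt (a j) θ₀) (hb : ContinuousAt b θ₀) {s : E}
    (hs : ∀ j, ballConstraint (v j θ₀) (a j θ₀) (b θ₀) s < 0) :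
    ∀ᶠ θ in 𝓝 θ₀, ∀ j, ballConstraint (v j θ) (a j θ) (b θ) s < 0 := by
  rw [Filter.eventually_all]
  intro j
  exact (Filter.Tendsto.ballConstraint (hv j) (ha j) hb tendsto_const_nhds).eventually_lt_const
    (hs j)

/-- Under Slater's condition the nearest point depends continuously on the data. -/
theorem continuousAt_of_isNearest [Finite ι] [FiniteDimensional ℝ E] [TopologicalSpace P]
    {p : P → E} {v : ι → P → ℝ} {a : ι → P → E} {b : P → ℝ} {R : P → E} {θ₀ : P}
    (hp : ContinuousAt p θ₀) (hv : ∀ j, ContinuousAt (v j) θ₀) (ha : ∀ j, ContinuousAt (a j) θ₀)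
    (hb : ContinuousAt b θ₀) (hb0 : 0 ≤ b θ₀)
    (hs : ∃ s, ∀ j, ballConstraint (v j θ₀) (a j θ₀) (b θ₀) s < 0)
    (hR : ∀ᶠ θ in 𝓝 θ₀, IsNearest (p θ) (fun j => v j θ) (fun j => a j θ) (b θ) (R θ)) :
    ContinuousAt R θ₀ := by
  obtain ⟨s, hs⟩ := hs
  have hbd : ∀ᶠ θ in 𝓝 θ₀, R θ ∈ Metric.closedBall (0 : E) (‖s + p θ₀‖ + ‖p θ₀‖ + 1) := by
    have h1 : Filter.Tendsto (fun θ => ‖s + p θ‖ + ‖p θ‖) (𝓝 θ₀) (𝓝 (‖s + p θ₀‖ + ‖p θ₀‖)) :=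
      (tendsto_const_nhds.add hp).norm.add hp.norm
    filter_upwards [hR, eventually_ballConstraint_neg hv ha hb hs,
      h1.eventually_lt_const (lt_add_one _)] with θ h2 h3 h4
    have h5 := h2.2 s fun j => (h3 j).le
    have h6 := norm_sub_le (R θ + p θ) (p θ)
    rw [add_sub_cancel_right] at h6
    rw [mem_closedBall_zero_iff]
    linarith
  refine (Filter.tendsto_iff_ultrafilter _ _ _).2 fun g hg => ?_
  obtain ⟨x, -, hx⟩ := (isCompact_closedBall (0 : E) _).ultrafilter_le_nhds' (g.map R)
    (hg hbd)
  have hx' : Filter.Tendsto R g (𝓝 x) := hx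
  -- Optimality of the limit `x`: a feasible competitor `y` is moved slightly towards the Slater
  -- point, which makes it feasible for all nearby parameters; the displacement then tends to zero.
  have hnear : IsNearest (p θ₀) (fun j => v j θ₀) (fun j => a j θ₀) (b θ₀) x := by
    refine ⟨fun j => ?_, fun y hy => ?_⟩
    · refine le_of_tendsto (Filter.Tendsto.ballConstraint ((hv j).mono_left hg)
        ((ha j).mono_left hg) (hb.mono_left hg) hx') ?_
      filter_upwards [hg hR] with θ h using h.1 j
    · have ht : ∀ᶠ t : ℝ in 𝓝[>] 0, ‖x + p θ₀‖ ≤ ‖y + t • (s - y) + p θ₀‖ := by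
        filter_upwards [Ioo_mem_nhdsGT zero_lt_one] with t ht
        have hfeas : ∀ j, ballConstraint (v j θ₀) (a j θ₀) (b θ₀) (y + t • (s - y)) < 0 := by
          intro j
          refine (ballConstraint_lineMap_le _ _ hb0 y s ht.1.le ht.2.le).trans_lt ?_
          exact add_neg_of_nonpos_of_neg
            (mul_nonpos_of_nonneg_of_nonpos (sub_nonneg.2 ht.2.le) (hy j))
            (mul_neg_of_pos_of_neg ht.1 (hs j))
        refine le_of_tendsto_of_tendsto (hx'.add (hp.mono_left hg)).norm
          (tendsto_const_nhds.add (hp.mono_left hg)).norm ?_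
        filter_upwards [hg hR, hg (eventually_ballConstraint_neg hv ha hb hfeas)] with θ h1 h2
        exact h1.2 _ fun j => (h2 j).le
      have hlim : Filter.Tendsto (fun t : ℝ => ‖y + t • (s - y) + p θ₀‖) (𝓝[>] 0)
          (𝓝 (‖y + (0 : ℝ) • (s - y) + p θ₀‖)) :=
        (Continuous.tendsto (by fun_prop) 0).mono_left nhdsWithin_le_nhds
      rw [zero_smul, add_zero] at hlim
      exact ge_of_tendsto hlim ht
  rwa [hR.self_of_nhds.eq hb0 hnear]

/-- Near a base point, linearly independent gradients stay uniformly linearly independent. -/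
theorem exists_eventually_mul_sum_abs_le {Z : Type*} [Fintype ι] [TopologicalSpace Z]
    {n : ι → Z → E} {z₀ : Z} (hn : ∀ j, ContinuousAt (n j) z₀) :
    ∃ c > 0, ∀ᶠ z in 𝓝 z₀, ∀ I : Set ι, LinearIndepOn ℝ (fun j => n j z₀) I →
      ∀ m : ι → ℝ, (∀ j ∉ I, m j = 0) → c * ∑ j, |m j| ≤ ‖∑ j, m j • n j z‖ := by
  have h1 : ∀ I : Set ι, ∃ c > 0, LinearIndepOn ℝ (fun j => n j z₀) I →
      ∀ m : ι → ℝ, (∀ j ∉ I, m j = 0) → c * ∑ j, |m j| ≤ ‖∑ j, m j • n j z₀‖ := by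
    intro I
    by_cases h : LinearIndepOn ℝ (fun j => n j z₀) I
    · obtain ⟨c, hc, hcI⟩ := h.exists_mul_sum_abs_le
      exact ⟨c, hc, fun _ => hcI⟩
    · exact ⟨1, one_pos, fun h' => absurd h' h⟩
  choose c hc hcI using h1
  -- Finitely many index sets give a common constant; half of it absorbs the perturbation of the
  -- vectors.
  obtain ⟨I₀, hI₀⟩ := Finite.exists_min c
  refine ⟨c I₀ / 2, half_pos (hc I₀), ?_⟩
  have hnear : ∀ᶠ z in 𝓝 z₀, ∀ j, ‖n j z - n j z₀‖ ≤ c I₀ / 2 := by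
    rw [Filter.eventually_all]
    intro j
    filter_upwards [Metric.tendsto_nhds.1 (hn j) _ (half_pos (hc I₀))] with z hz
    rw [← dist_eq_norm]
    exact hz.le
  filter_upwards [hnear] with z hz I hI m hm
  have h2 := hcI I hI m hm
  have h3 : c I₀ * ∑ j, |m j| ≤ c I * ∑ j, |m j| :=
    mul_le_mul_of_nonneg_right (hI₀ I) (Finset.sum_nonneg fun j _ => abs_nonneg _)
  have h4 : ‖∑ j, m j • n j z₀‖ ≤ ‖∑ j, m j • n j z‖ + c I₀ / 2 * ∑ j, |m j| := by
    have e : ∑ j, m j • n j z₀ = ∑ j, m j • n j z - ∑ j, m j • (n j z - n j z₀) := by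
      rw [← Finset.sum_sub_distrib]
      exact Finset.sum_congr rfl fun j _ => by module
    rw [e]
    refine (norm_sub_le _ _).trans ?_
    gcongr
    rw [Finset.mul_sum]
    refine (norm_sum_le _ _).trans (Finset.sum_le_sum fun j _ => ?_)
    rw [norm_smul, Real.norm_eq_abs, mul_comm]
    exact mul_le_mul_of_nonneg_right (hz j) (abs_nonneg _)
  linarith

/-- Under Slater's condition and a constant-rank condition, the nearest point is a Lipschitz
function of the parameter near the base point. -/
theorem exists_lipschitzOnWith_of_isNearest [Fintype ι] [FiniteDimensional ℝ E]
    [NormedAddCommGroup P] [NormedSpace ℝ P]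
    {p : P → E} {v : ι → P → ℝ} {a : ι → P → E} {b : P → ℝ} {R : P → E} {θ₀ : P}
    (hp : ContDiff ℝ 1 p) (hv : ∀ j, ContDiff ℝ 1 (v j)) (ha : ∀ j, ContDiff ℝ 1 (a j))
    (hb : ContDiff ℝ 1 b) (hb0 : ∀ θ, 0 ≤ b θ)
    (hs : ∃ s, ∀ j, ballConstraint (v j θ₀) (a j θ₀) (b θ₀) s < 0)
    (hR : ∀ᶠ θ in 𝓝 θ₀, IsNearest (p θ) (fun j => v j θ) (fun j => a j θ) (b θ) (R θ))
    (hrank : ∀ᶠ z in 𝓝 (R θ₀, θ₀), ∀ I : Set ι,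
      (∀ j ∈ I, ballConstraint (v j θ₀) (a j θ₀) (b θ₀) (R θ₀) = 0) →
      LinearIndepOn ℝ (fun j => a j z.2 + b z.2 • z.1) I →
      LinearIndepOn ℝ (fun j => a j θ₀ + b θ₀ • R θ₀) I) :
    ∃ U : Set P, IsOpen U ∧ θ₀ ∈ U ∧ ∃ L, LipschitzOnWith L R U := by
  obtain ⟨s, hs⟩ := hs
  have hslater := eventually_ballConstraint_neg (fun j => (hv j).continuous.continuousAt)
    (fun j => (ha j).continuous.continuousAt) hb.continuous.continuousAt hs
  have hcont : ∀ᶠ θ in 𝓝 θ₀, ContinuousAt R θ := by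
    filter_upwards [hslater, hR.eventually_nhds] with θ h1 h2
    exact continuousAt_of_isNearest hp.continuous.continuousAt
      (fun j => (hv j).continuous.continuousAt) (fun j => (ha j).continuous.continuousAt)
      hb.continuous.continuousAt (hb0 θ) ⟨s, h1⟩ h2
  have hRc : ContinuousAt R θ₀ := hcont.self_of_nhds
  obtain ⟨c, hc, hlow⟩ := exists_eventually_mul_sum_abs_le
    (n := fun j (z : E × P) => a j z.2 + b z.2 • z.1) (z₀ := (R θ₀, θ₀)) (fun j => by
      have h1 := (ha j).continuous
      have h2 := hb.continuous
      exact Continuous.continuousAt (by fun_prop))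
  obtain ⟨ε, hε, hbox⟩ := Metric.eventually_nhds_iff.1 (hlow.and hrank)
  -- all the data are Lipschitz with a common constant near the base point
  have hD : ContDiff ℝ 1 fun θ => (p θ, (fun j => v j θ), (fun j => a j θ), b θ) :=
    hp.prodMk ((contDiff_pi.2 hv).prodMk ((contDiff_pi.2 ha).prodMk hb))
  obtain ⟨K, N, hN, hK⟩ := hD.contDiffAt.exists_lipschitzOnWith (x := θ₀)
  have hinact : ∀ᶠ θ in 𝓝 θ₀, ∀ j, ballConstraint (v j θ) (a j θ) (b θ) (R θ) = 0 →
      ballConstraint (v j θ₀) (a j θ₀) (b θ₀) (R θ₀) = 0 := by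
    rw [Filter.eventually_all]
    intro j
    by_cases h : ballConstraint (v j θ₀) (a j θ₀) (b θ₀) (R θ₀) = 0
    · exact Filter.Eventually.of_forall fun _ _ => h
    · have h1 : Filter.Tendsto _ (𝓝 θ₀) _ := Filter.Tendsto.ballConstraint
        ((hv j).continuous.tendsto θ₀) ((ha j).continuous.tendsto θ₀) (hb.continuous.tendsto θ₀) hRc
      filter_upwards [h1.eventually_ne h] with θ h2 h3 using absurd h3 h2
  set M₀ := ‖R θ₀‖ + 1 + (b θ₀ + 1) with hM₀
  -- The last summand bounds the multiplier sums, by the KKT equation and uniform independence; `M₀`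
  -- bounds the minimizers and `b`.
  set M := M₀ + (‖R θ₀ + p θ₀‖ + 1) / c with hM
  have hev : ∀ᶠ θ in 𝓝 θ₀, ‖R θ‖ < ‖R θ₀‖ + 1 ∧ b θ < b θ₀ + 1 ∧
      ‖R θ + p θ‖ < ‖R θ₀ + p θ₀‖ + 1 ∧ dist (R θ) (R θ₀) < ε :=
    (hRc.norm.eventually_lt_const (lt_add_one _)).and
      (((hb.continuous.tendsto θ₀).eventually_lt_const (lt_add_one _)).and
        (((hRc.add (hp.continuous.tendsto θ₀)).norm.eventually_lt_const (lt_add_one _)).and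
          (Metric.tendsto_nhds.1 hRc ε hε)))
  obtain ⟨r, hr, hball⟩ := Metric.eventually_nhds_iff.1
    ((hslater.and hR).and ((hcont.and hN).and (hinact.and hev)))
  have hbM : 0 ≤ (‖R θ₀ + p θ₀‖ + 1) / c := by positivity
  have hM0 : 0 ≤ M := by
    have := hb0 θ₀
    positivity
  obtain ⟨L, hL0, hL⟩ := exists_norm_sub_le_of_common_support (ι := ι) (E := E) K M K.2 hM0 hc
  set S := Metric.ball θ₀ (min r ε) with hS
  have hSr : ∀ θ ∈ S, dist θ θ₀ < r := fun θ h => (Metric.mem_ball.1 h).trans_le (min_le_left _ _)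
  have hSε : ∀ θ ∈ S, dist θ θ₀ < ε := fun θ h => (Metric.mem_ball.1 h).trans_le (min_le_right _ _)
  -- Mixed pairs are needed because the common-support estimate uses the gradients at the parameter
  -- `θ` and the point `R θ'`.
  have hbox' : ∀ θ ∈ S, ∀ θ' ∈ S, dist ((R θ', θ) : E × P) (R θ₀, θ₀) < ε := fun θ h θ' h' =>
    max_lt (hball (hSr θ' h')).2.2.2.2.2.2 (hSε θ h)
  -- Independence is required at the base point, so that the uniform lower bound serves every
  -- parameter in the piece.
  let A : Set ι → Set P := fun I => {θ | LinearIndepOn ℝ (fun j => a j θ₀ + b θ₀ • R θ₀) I ∧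
    (∀ j ∈ I, ballConstraint (v j θ) (a j θ) (b θ) (R θ) = 0) ∧
    ∃ l : ι → ℝ, (∀ j, 0 ≤ l j) ∧ (∀ j ∉ I, l j = 0) ∧
      R θ + p θ + ∑ j, l j • (a j θ + b θ • R θ) = 0}
  have hcover : ∀ θ ∈ S, ∃ I, θ ∈ A I := by
    intro θ hθ
    obtain ⟨⟨h1, h2⟩, -, h3, -⟩ := hball (hSr θ hθ)
    obtain ⟨l, hl0, hlact, hlkkt, hlli⟩ := h2.exists_multipliers (hb0 θ) ⟨s, h1⟩
    exact ⟨{j | l j ≠ 0}, (hbox (hbox' θ hθ θ hθ)).2 _ (fun j hj => h3 j (hlact j hj)) hlli,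
      fun j hj => hlact j hj, l, hl0, fun j hj => not_not.1 hj, hlkkt⟩
  have hsum : ∀ θ ∈ S, ∀ I, LinearIndepOn ℝ (fun j => a j θ₀ + b θ₀ • R θ₀) I → ∀ l : ι → ℝ,
      (∀ j, 0 ≤ l j) → (∀ j ∉ I, l j = 0) → R θ + p θ + ∑ j, l j • (a j θ + b θ • R θ) = 0 →
      ∑ j, l j ≤ M := by
    intro θ hθ I hI l hl0 hlI hkkt
    have h1 := (hbox (hbox' θ hθ θ hθ)).1 I hI l hlI
    have h2 : ‖∑ j, l j • (a j θ + b θ • R θ)‖ = ‖R θ + p θ‖ := by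
      rw [eq_neg_of_add_eq_zero_right hkkt, norm_neg]
    have h3 : ∑ j, |l j| = ∑ j, l j := Finset.sum_congr rfl fun j _ => abs_of_nonneg (hl0 j)
    have h4 := (hball (hSr θ hθ)).2.2.2.2.2.1
    simp only [h2, h3] at h1
    have h5 : ∑ j, l j ≤ (‖R θ₀ + p θ₀‖ + 1) / c := by
      rw [le_div_iff₀ hc]
      linarith
    have h6 := hb0 θ₀
    have h7 := norm_nonneg (R θ₀)
    linarith
  have hpiece : ∀ I, ∀ θ ∈ S ∩ A I, ∀ θ' ∈ S ∩ A I, ‖R θ - R θ'‖ ≤ L * ‖θ - θ'‖ := by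
    rintro I θ ⟨hθ, hI, hact, l, hl0, hlI, hkkt⟩ θ' ⟨hθ', -, hact', l', hl0', hlI', hkkt'⟩
    have hd := hK.dist_le_mul θ (hball (hSr θ hθ)).2.1.2 θ' (hball (hSr θ' hθ')).2.1.2
    rw [dist_eq_norm, dist_eq_norm, Prod.norm_def, Prod.norm_def, Prod.norm_def] at hd
    simp only [sup_le_iff, Prod.fst_sub, Prod.snd_sub] at hd
    obtain ⟨hd1, hd2, hd3, hd4⟩ := hd
    have hKn : (0 : ℝ) ≤ K * ‖θ - θ'‖ := mul_nonneg K.2 (norm_nonneg _)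
    obtain ⟨e1, e2, -⟩ := (hball (hSr θ hθ)).2.2.2
    obtain ⟨e1', e2', -⟩ := (hball (hSr θ' hθ')).2.2.2
    have h6 := hb0 θ₀
    have h7 := norm_nonneg (R θ₀)
    refine hL (p θ) (p θ') (fun j => v j θ) (fun j => v j θ') (fun j => a j θ) (fun j => a j θ')
      (b θ) (b θ') (R θ) (R θ') l l' ‖θ - θ'‖ (norm_nonneg _) (hb0 θ) hl0 hl0' ?_ hkkt hkkt' hd1
      (fun j => (pi_norm_le_iff_of_nonneg hKn).1 hd2 j)
      (fun j => (pi_norm_le_iff_of_nonneg hKn).1 hd3 j) hd4 (by linarith) (by linarith)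
      (hsum θ hθ I hI l hl0 hlI hkkt) (hsum θ' hθ' I hI l' hl0' hlI' hkkt')
      ((hbox (hbox' θ hθ θ' hθ')).1 I hI _ fun j hj => by rw [hlI j hj, hlI' j hj, sub_zero])
    intro j hj
    have hjI : j ∈ I := by
      by_contra h
      exact hj.elim (fun h' => h' (hlI j h)) fun h' => h' (hlI' j h)
    exact ⟨hact j hjI, hact' j hjI⟩
  refine ⟨S, Metric.isOpen_ball, Metric.mem_ball_self (lt_min hr hε), ⟨L, hL0⟩, ?_⟩
  refine LipschitzOnWith.of_dist_le_mul fun x hx y hy => ?_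
  rw [dist_eq_norm, dist_eq_norm]
  exact norm_sub_le_of_finite_cover (convex_ball θ₀ _)
    (fun θ hθ => (hball (hSr θ hθ)).2.1.1.continuousWithinAt) hcover hpiece hy hx

end ParametricNearest

/-! ### Gradients and application to the robust safe gradient flow. -/

theorem ContDiff.gradient {E : Type*} [NormedAddCommGroup E] [InnerProductSpace ℝ E]
    [CompleteSpace E] {f : E → ℝ} (hf : ContDiff ℝ 2 f) : ContDiff ℝ 1 (∇ f) :=
  ((InnerProductSpace.toDual ℝ E).symm.contDiff).comp (hf.fderiv_right (by norm_num))

theorem gradient_ballConstraint {E : Type*} [NormedAddCommGroup E] [InnerProductSpace ℝ E]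
    [CompleteSpace E] (v : ℝ) (a : E) (b : ℝ) (x : E) :
    ∇ (ballConstraint v a b) x = a + b • x := by
  refine HasGradientAt.gradient ?_
  rw [hasGradientAt_iff_hasFDerivAt]
  have h1 : HasFDerivAt (fun y : E => ⟪a, y⟫) (innerSL ℝ a) x := (innerSL ℝ a).hasFDerivAt
  have h2 := ((hasStrictFDerivAt_norm_sq x).hasFDerivAt).const_mul (b / 2)
  refine ((h1.const_add v).add h2).congr_fderiv ?_
  ext y
  simp only [add_apply, smul_apply, innerSL_apply_apply,
    InnerProductSpace.toDual_apply_apply, inner_add_left, real_inner_smul_left, smul_eq_mul,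
    nsmul_eq_mul, Nat.cast_ofNat]
  ring

namespace RSGF

variable {d q : ℕ} {α : ℝ} {β V₀ : EuclideanSpace ℝ (Fin d) → ℝ}
  {V : Fin q → EuclideanSpace ℝ (Fin d) → ℝ} {θ ξ : EuclideanSpace ℝ (Fin d)}

theorem isSolution_iff_isNearest : IsSolution α β V₀ V θ ξ ↔
    IsNearest (∇ V₀ θ) (fun j => α * V j θ) (fun j => ∇ (V j) θ) (β θ) ξ := by
  refine and_congr Iff.rfl ?_
  rw [isMinOn_iff]
  refine forall₂_congr fun y _ => ?_
  simp only [objective]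
  rw [mul_le_mul_iff_right₀ (by norm_num : (0 : ℝ) < 1 / 2)]
  exact pow_le_pow_iff_left₀ (norm_nonneg _) (norm_nonneg _) two_ne_zero

theorem wellDefinedAt_of_slater (hβ : 0 < β θ)
    (hs : SlaterCondition fun j ξ => constraint α β V j ξ θ) : WellDefinedAt α β V₀ V θ := by
  obtain ⟨s, hs⟩ := hs
  obtain ⟨x, hx⟩ := exists_isNearest (∇ V₀ θ) (v := fun j => α * V j θ)
    (a := fun j => ∇ (V j) θ) (b := β θ) ⟨s, fun j => (hs j).le⟩
  have hex : ∃ ξ, IsSolution α β V₀ V θ ξ := ⟨x, isSolution_iff_isNearest.2 hx⟩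
  refine ⟨⟨x, isSolution_iff_isNearest.2 hx, fun y hy => ?_⟩, ?_⟩
  · exact (isSolution_iff_isNearest.1 hy).eq hβ.le hx
  · rw [vectorField, dif_pos hex]
    exact hex.choose_spec

/-- The Mangasarian-Fromovitz condition at a feasible point yields Slater's condition for the
program that defines the vector field. -/
theorem slaterCondition_of_mfcqAt (hα : 0 < α) (hθ : θ ∈ feasibleSet V) (h : MFCQAt V θ) :
    SlaterCondition fun j ξ => constraint α β V j ξ θ := by
  obtain ⟨ξ, hξ⟩ := h
  -- For small t > 0, an inactive constraint keeps its negative constant term, while for an active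
  -- one the negative linear term dominates the quadratic one.
  have hev : ∀ j, ∀ᶠ t : ℝ in 𝓝[>] 0, constraint α β V j (t • ξ) θ < 0 := by
    intro j
    simp only [constraint, inner_smul_right, norm_smul, mul_pow, Real.norm_eq_abs, sq_abs]
    rcases (hθ j).lt_or_eq with hj | hj
    · have hc : Filter.Tendsto (fun t : ℝ => α * V j θ + t * ⟪∇ (V j) θ, ξ⟫
          + β θ / 2 * (t ^ 2 * ‖ξ‖ ^ 2)) (𝓝 0) (𝓝 (α * V j θ + 0 * ⟪∇ (V j) θ, ξ⟫
          + β θ / 2 * (0 ^ 2 * ‖ξ‖ ^ 2))) := Continuous.tendsto (by fun_prop) 0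
      refine nhdsWithin_le_nhds (hc.eventually_lt_const ?_)
      simpa using mul_neg_of_pos_of_neg hα hj
    · have hc : Filter.Tendsto (fun t : ℝ => ⟪∇ (V j) θ, ξ⟫ + t * (β θ / 2 * ‖ξ‖ ^ 2)) (𝓝 0)
          (𝓝 (⟪∇ (V j) θ, ξ⟫ + 0 * (β θ / 2 * ‖ξ‖ ^ 2))) := Continuous.tendsto (by fun_prop) 0
      rw [zero_mul, add_zero] at hc
      filter_upwards [nhdsWithin_le_nhds (hc.eventually_lt_const (hξ j hj)), self_mem_nhdsWithin]
        with t ht ht0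
      rw [hj]
      nlinarith [mul_neg_of_pos_of_neg (Set.mem_Ioi.1 ht0) ht]
  obtain ⟨t, ht⟩ := (Filter.eventually_all.2 hev).exists
  exact ⟨t • ξ, ht⟩

/-- Slater's condition and the constant-rank condition make the vector field well defined and
Lipschitz near a point. -/
theorem exists_isOpen_lipschitzOnWith (hβ_pos : ∀ θ, 0 < β θ) (hβ : ContDiff ℝ 2 β)
    (hV₀ : ContDiff ℝ 2 V₀) (hV : ∀ j, ContDiff ℝ 2 (V j))
    (hs : SlaterCondition fun j ξ => constraint α β V j ξ θ)
    (hcrc : ParametricCRCAt (constraint α β V) (vectorField α β V₀ V θ) θ) :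
    ∃ U : Set (EuclideanSpace ℝ (Fin d)), IsOpen U ∧ θ ∈ U ∧
      (∀ η ∈ U, WellDefinedAt α β V₀ V η) ∧ ∃ L, LipschitzOnWith L (vectorField α β V₀ V) U := by
  have hv : ∀ j, ContDiff ℝ 1 fun η => α * V j η := fun j =>
    contDiff_const.mul ((hV j).of_le (by norm_num))
  have ha : ∀ j, ContDiff ℝ 1 (∇ (V j)) := fun j => (hV j).gradient
  have hb : ContDiff ℝ 1 β := hβ.of_le (by norm_num)
  have hwd : ∀ᶠ η in 𝓝 θ, WellDefinedAt α β V₀ V η := by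
    obtain ⟨s, hs⟩ := hs
    filter_upwards [eventually_ballConstraint_neg (fun j => (hv j).continuous.continuousAt)
      (fun j => (ha j).continuous.continuousAt) hb.continuous.continuousAt hs] with η hη
    exact wellDefinedAt_of_slater (hβ_pos η) ⟨s, hη⟩
  obtain ⟨N, hN, hrank⟩ := hcrc
  obtain ⟨U, hU, hθU, L, hL⟩ := exists_lipschitzOnWith_of_isNearest (R := vectorField α β V₀ V)
    hV₀.gradient hv ha hb (fun η => (hβ_pos η).le) hs
    (hwd.mono fun η hη => isSolution_iff_isNearest.1 hη.2) (by
      filter_upwards [hN] with z hz I hI hli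
      obtain ⟨r, hr⟩ := hrank I hI
      have hgrad : ∀ (j : Fin q) (ζ η : EuclideanSpace ℝ (Fin d)),
          ∇ (fun x => constraint α β V j x η) ζ = ∇ (V j) η + β η • ζ :=
        fun j ζ η => gradient_ballConstraint (α * V j η) (∇ (V j) η) (β η) ζ
      -- Constant rank is used only backwards: independence at a nearby `z` implies independence at
      -- the base point.
      have h1 := (hr z hz).trans (hr _ (mem_of_mem_nhds hN)).symm
      simp only [hgrad] at h1
      exact hli.of_finrank_image_eq h1)
  obtain ⟨W, hWsub, hW, hθW⟩ := mem_nhds_iff.1 hwd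
  exact ⟨U ∩ W, hU.inter hW, ⟨hθU, hθW⟩, fun η hη => hWsub hη.2, L,
    hL.mono Set.inter_subset_left⟩

end RSGF

theorem mainTheorem6 (d q : ℕ) (α : ℝ) (hα : 0 < α)
    (β V₀ : EuclideanSpace ℝ (Fin d) → ℝ) (V : Fin q → EuclideanSpace ℝ (Fin d) → ℝ)
    (hβ_pos : ∀ θ, 0 < β θ)
    (hβ : ContDiff ℝ 2 β) (hV₀ : ContDiff ℝ 2 V₀) (hV : ∀ j, ContDiff ℝ 2 (V j)) :
    (RSGF.QualifiedInside α β V₀ V →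
      ∃ U : Set (EuclideanSpace ℝ (Fin d)), IsOpen U ∧ RSGF.feasibleSet V ⊆ U ∧
        (∀ θ ∈ U, RSGF.WellDefinedAt α β V₀ V θ) ∧
        LocallyLipschitzOn U (RSGF.vectorField α β V₀ V)) ∧
    (RSGF.QualifiedInside α β V₀ V → RSGF.QualifiedOutside α β V₀ V →
      (∀ θ, RSGF.WellDefinedAt α β V₀ V θ) ∧
        LocallyLipschitz (RSGF.vectorField α β V₀ V)) := by
  have hin : RSGF.QualifiedInside α β V₀ V → ∀ θ ∈ RSGF.feasibleSet V, _ := fun h θ hθ =>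
    RSGF.exists_isOpen_lipschitzOnWith hβ_pos hβ hV₀ hV
      (RSGF.slaterCondition_of_mfcqAt hα hθ (h θ hθ).1) (h θ hθ).2
  refine ⟨fun h => ?_, fun h h' => ?_⟩
  · choose! U hU hθU hwd hL using hin h
    refine ⟨⋃ θ ∈ RSGF.feasibleSet V, U θ, isOpen_biUnion hU,
      fun θ hθ => Set.mem_biUnion hθ (hθU θ hθ), fun η hη => ?_, fun η hη => ?_⟩
    · obtain ⟨θ, hθ, hηθ⟩ := Set.mem_iUnion₂.1 hη
      exact hwd θ hθ η hηθ
    · obtain ⟨θ, hθ, hηθ⟩ := Set.mem_iUnion₂.1 hη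
      obtain ⟨L, hL⟩ := hL θ hθ
      exact ⟨L, U θ, mem_nhdsWithin_of_mem_nhds ((hU θ hθ).mem_nhds hηθ), hL⟩
  · have hall : ∀ θ, ∃ U : Set (EuclideanSpace ℝ (Fin d)), IsOpen U ∧ θ ∈ U ∧
        (∀ η ∈ U, RSGF.WellDefinedAt α β V₀ V η) ∧
        ∃ L, LipschitzOnWith L (RSGF.vectorField α β V₀ V) U := by
      intro θ
      by_cases hθ : θ ∈ RSGF.feasibleSet V
      · exact hin h θ hθ
      · exact RSGF.exists_isOpen_lipschitzOnWith hβ_pos hβ hV₀ hV (h' θ hθ).1 (h' θ hθ).2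
    refine ⟨fun θ => ?_, fun θ => ?_⟩
    · obtain ⟨U, -, hθU, hwd, -⟩ := hall θ
      exact hwd θ hθU
    · obtain ⟨U, hU, hθU, -, L, hL⟩ := hall θ
      exact ⟨L, U, hU.mem_nhds hθU, hL⟩
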